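/- For a subset $K$ of a Banach space $X$ and an integer $n\ge 0$, let $\varepsilon_n(K)_X$ denote the $n$-th entropy number of $K$, i.e. the infimum of all $\varepsilon>0$ for which $K$ can be covered by $2^n$ balls of $X$ of radius $\varepsilon$; write $\ell_\infty^{m}=(\mathbb{R}^{m},\|\cdot\|_{\ell_\infty})$. There is an absolute constant $C>0$ such that the following holds. Let $X$ be a (real) Banach space and let $K\subset X$ be compact. Then for every integer $n\ge 1$ there are Lipschitz mappings $$a_n:X\to \ell_\infty^{26n},\qquad M_n:\ell_\infty^{26n}\to X,$$ each with Lipschitz constant at most $Cn^{5/4}$, such that $$\sup_{f\in K}\|f-M_n(a_n(f))\|_X\le C\,n^{5/2}\,\varepsilon_n(K)_X .$$ -/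

import Mathlib

open scoped NNReal

universe u

/-- The entropy number `ε_n(K)_X`: the infimum of all `ε > 0` for which `2 ^ n` balls of radius `ε`
(with centres anywhere in `X`, repetitions allowed) cover `K`. For compact `K` the set of such `ε`
is nonempty and bounded below by `0`. -/
noncomputable def entropyNumber {X : Type u} [PseudoMetricSpace X] (n : ℕ) (K : Set X) : ℝ :=
  sInf {ε : ℝ | 0 < ε ∧ ∃ c : Fin (2 ^ n) → X, K ⊆ ⋃ i, Metric.closedBall (c i) ε}

/-! Take a net `A` of at most `2 ^ n` points within `2 ε_n(K)` of every point of `K`. It is enough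
to factor the identity of `A` through `ℓ_∞^{26n}` by Lipschitz maps defined on the whole spaces: `M
∘ a` then displaces `f` by at most `1 + Lip(a) Lip(M)` times its distance to the net.

The map `a` comes from a Bourgain-type embedding (`exists_embedding`). For each pair of points,
`exists_bourgain_scales` splits half the distance into `2n` gaps, each detected by the distance to a
random set of the right density. Averaging over pairs fixes one set per scale. Random signs then
merge the `2n` distance functions into a single `2n`-Lipschitz coordinate, which by Paley–Zygmund
sees a fixed proportion of the pairs at the size of the `ℓ_2` norm of their gaps, hence at order
`dist / √n`. Using one coordinate for all scales keeps the dimension linear in `n`: there are at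
most `4 ^ n` pairs, so `26n` greedy choices separate them all.

The map `M` extends the inverse from the image of `A` (`exists_lipschitz_extension`). Averaging
nearest-point values over cubes costs a factor linear in the dimension, whatever the Banach target.
The embedding has constant of order `n`, and its extended inverse `√n · n`; rescaling by `n ^ (1/4)`
makes both `n ^ (5/4)`. -/

/-! ### Random subsets and random signs -/

/-- The probability that a random subset of `A`, missing each point with probability `s`,
is disjoint from `G`. -/
theorem sum_powerset_disjoint_weight {α : Type*} [DecidableEq α] {A G : Finset α} (hG : G ⊆ A)
    (s : ℝ) :
    ∑ S ∈ A.powerset with Disjoint S G, (1 - s) ^ S.card * s ^ (A.card - S.card) = s ^ G.card := by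
  have hset : A.powerset.filter (fun S => Disjoint S G) = (A \ G).powerset := by
    ext S
    simp [Finset.subset_sdiff]
  have hcard : (A \ G).card + G.card = A.card := Finset.card_sdiff_add_card_eq_card hG
  rw [hset]
  have := Finset.sum_pow_mul_eq_add_pow (1 - s) s (A \ G)
  rw [sub_add_cancel, one_pow] at this
  calc _ = ∑ S ∈ (A \ G).powerset,
        ((1 - s) ^ S.card * s ^ ((A \ G).card - S.card)) * s ^ G.card := by
        refine Finset.sum_congr rfl fun S hS => ?_
        have hS' := Finset.card_le_card (Finset.mem_powerset.1 hS)
        rw [mul_assoc, ← pow_add]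
        congr 2
        omega
    _ = s ^ G.card := by rw [← Finset.sum_mul, this, one_mul]

/-- The probability that a random subset misses `G` and hits `H`. -/
theorem sum_powerset_hit_weight {α : Type*} [DecidableEq α] {A G H : Finset α} (hG : G ⊆ A)
    (hH : H ⊆ A) (hGH : Disjoint G H) (s : ℝ) :
    ∑ S ∈ A.powerset with (Disjoint S G ∧ ¬ Disjoint S H),
      (1 - s) ^ S.card * s ^ (A.card - S.card) = s ^ G.card * (1 - s ^ H.card) := by
  have h1 := sum_powerset_disjoint_weight hG s
  have h2 := sum_powerset_disjoint_weight (Finset.union_subset hG hH) s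
  rw [Finset.card_union_of_disjoint hGH, pow_add] at h2
  -- The event is the difference of two: missing `G`, and missing `G ∪ H`.
  rw [← Finset.sum_filter_add_sum_filter_not _ (fun S => Disjoint S H), Finset.filter_filter,
    Finset.filter_filter] at h1
  simp only [Finset.disjoint_union_right] at h2
  linarith

/-- Averaging over random subsets: some subset hits and misses a prescribed weighted fraction
of the given pairs. -/
theorem exists_subset_hitting {α κ : Type*} [DecidableEq α] (A : Finset α) (P : Finset κ)
    (G H : κ → Finset α) (w : κ → ℝ) {s p : ℝ} (hs0 : 0 < s) (hs1 : s < 1)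
    (hw : ∀ k ∈ P, 0 ≤ w k)
    (h : ∀ k ∈ P, 0 < w k → G k ⊆ A ∧ H k ⊆ A ∧ Disjoint (G k) (H k) ∧
      p ≤ s ^ (G k).card * (1 - s ^ (H k).card)) :
    ∃ S ⊆ A, p * ∑ k ∈ P, w k ≤
      ∑ k ∈ P, if Disjoint S (G k) ∧ ¬ Disjoint S (H k) then w k else 0 := by
  set μ : Finset α → ℝ := fun S => (1 - s) ^ S.card * s ^ (A.card - S.card) with hμ
  have hμpos : ∀ S, 0 < μ S := fun S => mul_pos (pow_pos (by linarith) _) (pow_pos hs0 _)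
  have htot : ∑ S ∈ A.powerset, μ S = 1 := by
    have := Finset.sum_pow_mul_eq_add_pow (1 - s) s A
    rwa [sub_add_cancel, one_pow] at this
  have hle : ∑ S ∈ A.powerset, μ S * (p * ∑ k ∈ P, w k) ≤ ∑ S ∈ A.powerset, μ S *
      ∑ k ∈ P, if Disjoint S (G k) ∧ ¬ Disjoint S (H k) then w k else 0 := by
    rw [← Finset.sum_mul, htot, one_mul, Finset.mul_sum]
    simp_rw [Finset.mul_sum]
    rw [Finset.sum_comm]
    refine Finset.sum_le_sum fun k hk => ?_
    have : ∑ S ∈ A.powerset, μ S * (if Disjoint S (G k) ∧ ¬ Disjoint S (H k) then w k else 0) =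
        (∑ S ∈ A.powerset with (Disjoint S (G k) ∧ ¬ Disjoint S (H k)), μ S) * w k := by
      rw [Finset.sum_mul, Finset.sum_filter]
      refine Finset.sum_congr rfl fun S _ => ?_
      split_ifs <;> simp
    rw [this]
    rcases (hw k hk).eq_or_lt with h0 | h0
    · simp [← h0]
    · obtain ⟨hG, hH, hGH, hp⟩ := h k hk h0
      rw [hμ, sum_powerset_hit_weight hG hH hGH]
      exact mul_le_mul_of_nonneg_right hp h0.le
  obtain ⟨S, hS, hle'⟩ := Finset.exists_le_of_sum_le ⟨∅, Finset.empty_mem_powerset A⟩ hle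
  exact ⟨S, Finset.mem_powerset.1 hS, le_of_mul_le_mul_left hle' (hμpos S)⟩

/-- The sum of `t` over `J` with sign `+` on `S` and sign `-` elsewhere. -/
noncomputable def signedSum {ι : Type*} [DecidableEq ι] (J S : Finset ι) (t : ι → ℝ) : ℝ :=
  ∑ j ∈ J, if j ∈ S then t j else -t j

theorem signedSum_insert_of_notMem {ι : Type*} [DecidableEq ι] {J S : Finset ι} {a : ι}
    (ha : a ∉ J) (hS : S ⊆ J) (t : ι → ℝ) :
    signedSum (insert a J) S t = signedSum J S t - t a := by
  have : a ∉ S := fun h => ha (hS h)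
  rw [signedSum, Finset.sum_insert ha, if_neg this, signedSum]
  ring

theorem signedSum_insert_insert {ι : Type*} [DecidableEq ι] {J S : Finset ι} {a : ι}
    (ha : a ∉ J) (t : ι → ℝ) :
    signedSum (insert a J) (insert a S) t = signedSum J S t + t a := by
  rw [signedSum, Finset.sum_insert ha, if_pos (Finset.mem_insert_self a S), signedSum, add_comm]
  congr 1
  refine Finset.sum_congr rfl fun j hj => ?_
  have : j ≠ a := fun h => ha (h ▸ hj)
  simp [this]

/-- Cross terms cancel between the two signs of each new index. -/
theorem sum_signedSum_sq {ι : Type*} [DecidableEq ι] (J : Finset ι) (t : ι → ℝ) :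
    ∑ S ∈ J.powerset, signedSum J S t ^ 2 = 2 ^ J.card * ∑ j ∈ J, t j ^ 2 := by
  induction J using Finset.induction_on with
  | empty => simp [signedSum]
  | insert a J ha ih =>
    rw [Finset.sum_powerset_insert ha, ← Finset.sum_add_distrib]
    have : ∀ S ∈ J.powerset, signedSum (insert a J) S t ^ 2 +
        signedSum (insert a J) (insert a S) t ^ 2 = 2 * signedSum J S t ^ 2 + 2 * t a ^ 2 := by
      intro S hS
      rw [signedSum_insert_of_notMem ha (Finset.mem_powerset.1 hS), signedSum_insert_insert ha]
      ring
    rw [Finset.sum_congr rfl this, Finset.sum_add_distrib, ← Finset.mul_sum, ih,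
      Finset.sum_const, Finset.card_powerset, Finset.sum_insert ha, Finset.card_insert_of_notMem ha]
    push_cast [nsmul_eq_mul]
    ring

/-- Odd terms cancel between the two signs of a new index, and the `12 t² u²` left over is exactly
the cross term of `3 (V + t²)²`. This is the fourth moment needed for Paley–Zygmund. -/
theorem sum_signedSum_pow_four_le {ι : Type*} [DecidableEq ι] (J : Finset ι) (t : ι → ℝ) :
    ∑ S ∈ J.powerset, signedSum J S t ^ 4 ≤ 2 ^ J.card * (3 * (∑ j ∈ J, t j ^ 2) ^ 2) := by
  induction J using Finset.induction_on with
  | empty => simp [signedSum]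
  | insert a J ha ih =>
    rw [Finset.sum_powerset_insert ha, ← Finset.sum_add_distrib]
    have : ∀ S ∈ J.powerset, signedSum (insert a J) S t ^ 4 +
        signedSum (insert a J) (insert a S) t ^ 4 =
        2 * signedSum J S t ^ 4 + 12 * t a ^ 2 * signedSum J S t ^ 2 + 2 * t a ^ 4 := by
      intro S hS
      rw [signedSum_insert_of_notMem ha (Finset.mem_powerset.1 hS), signedSum_insert_insert ha]
      ring
    rw [Finset.sum_congr rfl this, Finset.sum_add_distrib, Finset.sum_add_distrib,
      ← Finset.mul_sum, ← Finset.mul_sum, sum_signedSum_sq,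
      Finset.sum_const, Finset.card_powerset, Finset.sum_insert ha, Finset.card_insert_of_notMem ha]
    push_cast [nsmul_eq_mul]
    have h4 : (0 : ℝ) ≤ 2 ^ J.card * t a ^ 4 := by positivity
    rw [pow_succ (2 : ℝ)]
    nlinarith [ih, h4]

/-- A Paley–Zygmund bound: a random signed sum has square at least a twentieth of its variance
with probability at least `3 / 10`. -/
theorem card_signedSum_sq_ge {ι : Type*} [DecidableEq ι] (J : Finset ι) (t : ι → ℝ)
    (hV : 0 < ∑ j ∈ J, t j ^ 2) :
    (2 : ℝ) ^ J.card * (3 / 10) ≤ ∑ S ∈ J.powerset,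
      if (∑ j ∈ J, t j ^ 2) / 20 ≤ signedSum J S t ^ 2 then (1 : ℝ) else 0 := by
  set V := ∑ j ∈ J, t j ^ 2 with hVdef
  -- A quadratic in `u = signedSum² / V` lying below the indicator of `u ≥ 1/20`. Since `u` has mean
  -- `1` and second moment at most `3`, its mean is at least `2/3 · 19/20 - 3/9 = 3/10`.
  have hpt : ∀ S ∈ J.powerset, 2 / 3 * (signedSum J S t ^ 2 / V - 1 / 20)
      - 1 / 9 * (signedSum J S t ^ 4 / V ^ 2) ≤
      if V / 20 ≤ signedSum J S t ^ 2 then (1 : ℝ) else 0 := by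
    intro S _
    set u := signedSum J S t ^ 2 / V with hu
    have hu4 : signedSum J S t ^ 4 / V ^ 2 = u ^ 2 := by rw [hu, div_pow]; ring
    rw [hu4]
    split_ifs with hc
    · nlinarith [sq_nonneg (u - 3)]
    · have : u < 1 / 20 := by
        rw [hu, div_lt_iff₀ hV]; linarith [not_le.1 hc]
      nlinarith [sq_nonneg u]
  refine le_trans ?_ (Finset.sum_le_sum hpt)
  rw [Finset.sum_sub_distrib, ← Finset.mul_sum, ← Finset.mul_sum, Finset.sum_sub_distrib,
    Finset.sum_const, ← Finset.sum_div, ← Finset.sum_div, sum_signedSum_sq, ← hVdef,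
    Finset.card_powerset]
  have h4 : (∑ S ∈ J.powerset, signedSum J S t ^ 4) / V ^ 2 ≤ 2 ^ J.card * 3 := by
    rw [div_le_iff₀ (by positivity)]
    have := sum_signedSum_pow_four_le J t
    rw [← hVdef] at this
    linarith
  rw [mul_div_assoc, div_self hV.ne']
  push_cast [nsmul_eq_mul]
  nlinarith

/-- Averaging over signs: one choice of signs is good for three tenths of the vectors. -/
theorem exists_signs {ι κ : Type*} [DecidableEq ι] (J : Finset ι) (Q : Finset κ)
    (t : κ → ι → ℝ) (hV : ∀ k ∈ Q, 0 < ∑ j ∈ J, t k j ^ 2) :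
    ∃ S ⊆ J, (3 / 10 : ℝ) * Q.card ≤
      (Q.filter fun k => (∑ j ∈ J, t k j ^ 2) / 20 ≤ signedSum J S (t k) ^ 2).card := by
  have hle : ∑ S ∈ J.powerset, (3 / 10 : ℝ) * Q.card ≤ ∑ S ∈ J.powerset, ∑ k ∈ Q,
      if (∑ j ∈ J, t k j ^ 2) / 20 ≤ signedSum J S (t k) ^ 2 then (1 : ℝ) else 0 := by
    rw [Finset.sum_comm, Finset.sum_const, Finset.card_powerset]
    have := Finset.sum_le_sum fun k hk => card_signedSum_sq_ge J (t k) (hV k hk)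
    rw [Finset.sum_const] at this
    push_cast [nsmul_eq_mul] at this ⊢
    linarith
  obtain ⟨S, hS, h⟩ := Finset.exists_le_of_sum_le ⟨∅, Finset.empty_mem_powerset J⟩ hle
  refine ⟨S, Finset.mem_powerset.1 hS, h.trans_eq ?_⟩
  rw [Finset.sum_boole]

open Classical in
/-- Greedy covering: if every subset of `P` has a fraction `1 - q` of its elements satisfied by a
single `φ`, then `k` choices leave at most a fraction `q ^ k` unsatisfied. -/
theorem exists_greedy_cover {κ Φ : Type*} (sat : Φ → κ → Prop) (P : Finset κ) {q : ℝ}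
    (hq : 0 ≤ q)
    (h : ∀ Q ⊆ P, ∃ φ, (1 - q) * Q.card ≤ ((Q.filter fun k => sat φ k).card : ℝ)) (m : ℕ) :
    ∃ φ : Fin m → Φ, ((P.filter fun k => ∀ i, ¬ sat (φ i) k).card : ℝ) ≤ q ^ m * P.card := by
  induction m with
  | zero => exact ⟨Fin.elim0, by simp⟩
  | succ m ih =>
    obtain ⟨φ, hφ⟩ := ih
    set Q := P.filter fun k => ∀ i, ¬ sat (φ i) k with hQ
    obtain ⟨ψ, hψ⟩ := h Q (Finset.filter_subset _ _)
    refine ⟨Fin.cons ψ φ, ?_⟩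
    have hset : P.filter (fun k => ∀ i, ¬ sat ((Fin.cons ψ φ : Fin (m + 1) → Φ) i) k) =
        Q.filter fun k => ¬ sat ψ k := by
      rw [hQ, Finset.filter_filter]
      refine Finset.filter_congr fun k _ => ?_
      rw [Fin.forall_fin_succ]
      simp [and_comm]
    have hsum := Finset.card_filter_add_card_filter_not (s := Q) (fun k => sat ψ k)
    rw [hset, pow_succ]
    have hsum' : ((Q.filter fun k => sat ψ k).card : ℝ) + (Q.filter fun k => ¬ sat ψ k).card
        = Q.card := by exact_mod_cast hsum
    nlinarith [mul_le_mul_of_nonneg_left hφ hq]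

/-! ### Embedding a finite metric space into few coordinates -/

/-- A radius at which the number of points of `A` around `z` passes the threshold `β`. -/
theorem exists_threshold_radius {X : Type*} [PseudoMetricSpace X] (A : Finset X) (z : X) {β : ℝ}
    (hβ : 0 < β) (hA : β ≤ A.card) :
    ∃ ρ : ℝ, 0 ≤ ρ ∧ ((A.filter fun a => dist a z < ρ).card : ℝ) < β ∧
      β ≤ (A.filter fun a => dist a z ≤ ρ).card := by
  -- The radius is the least distance from `z` to a point of `T`. If the open ball still held `β`
  -- points, its farthest point would be a closer element of `T`.
  set T := A.filter fun b => β ≤ (A.filter fun a => dist a z ≤ dist b z).card with hT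
  have hmax : ∀ B ⊆ A, β ≤ B.card → ∃ b ∈ B, b ∈ T := by
    intro B hB hcard
    have hne : B.Nonempty := by
      rw [← Finset.card_pos]
      exact_mod_cast hβ.trans_le hcard
    obtain ⟨b, hb, hbmax⟩ := B.exists_max_image (fun a => dist a z) hne
    refine ⟨b, hb, Finset.mem_filter.2 ⟨hB hb, hcard.trans ?_⟩⟩
    exact_mod_cast Finset.card_le_card fun a ha => Finset.mem_filter.2 ⟨hB ha, hbmax a ha⟩
  obtain ⟨b₀, -, hb₀⟩ := hmax A subset_rfl hA
  obtain ⟨b, hb, hbmin⟩ := T.exists_min_image (fun a => dist a z) ⟨b₀, hb₀⟩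
  refine ⟨dist b z, dist_nonneg, ?_, (Finset.mem_filter.1 hb).2⟩
  by_contra! hcon
  obtain ⟨c, hc, hcT⟩ := hmax _ (Finset.filter_subset _ _) hcon
  exact absurd (Finset.mem_filter.1 hc).2 (not_lt.2 (hbmin c hcT))

/-- The common threshold radius of two points, cut off at `D`. -/
theorem exists_threshold_radius_pair {X : Type*} [PseudoMetricSpace X] (A : Finset X) (x y : X)
    {β D : ℝ} (hβ : 0 < β) (hD : 0 ≤ D) :
    ∃ ρ : ℝ, 0 ≤ ρ ∧ ρ ≤ D ∧
      (((A.filter fun a => dist a x < ρ).card : ℝ) < β ∨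
        ((A.filter fun a => dist a y < ρ).card : ℝ) < β) ∧
      (ρ = D ∨ (β ≤ (A.filter fun a => dist a x ≤ ρ).card ∧
        β ≤ (A.filter fun a => dist a y ≤ ρ).card)) := by
  have mono_lt : ∀ z : X, ∀ r s : ℝ, r ≤ s → ((A.filter fun a => dist a z < r).card : ℝ) ≤
      (A.filter fun a => dist a z < s).card := fun z r s h => by
    exact_mod_cast Finset.card_le_card
      (Finset.monotone_filter_right A fun a _ (ha : dist a z < r) => ha.trans_le h)
  have mono_le : ∀ z : X, ∀ r s : ℝ, r ≤ s → ((A.filter fun a => dist a z ≤ r).card : ℝ) ≤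
      (A.filter fun a => dist a z ≤ s).card := fun z r s h => by
    exact_mod_cast Finset.card_le_card
      (Finset.monotone_filter_right A fun a _ (ha : dist a z ≤ r) => ha.trans h)
  rcases lt_or_ge (A.card : ℝ) β with hA | hA
  · refine ⟨D, hD, le_rfl, Or.inl (lt_of_le_of_lt ?_ hA), Or.inl rfl⟩
    exact_mod_cast Finset.card_filter_le _ _
  · obtain ⟨r, hr, hr1, hr2⟩ := exists_threshold_radius A x hβ hA
    obtain ⟨s, hs, hs1, hs2⟩ := exists_threshold_radius A y hβ hA
    -- At the larger threshold both closed balls are full, while the open ball at the point owning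
    -- that threshold is not.
    refine ⟨min D (max r s), le_min hD (hr.trans (le_max_left _ _)), min_le_left _ _, ?_, ?_⟩
    · rcases le_total r s with h | h
      · exact Or.inr ((mono_lt y _ s (by simp [h])).trans_lt hs1)
      · exact Or.inl ((mono_lt x _ r (by simp [h])).trans_lt hr1)
    · rcases le_total D (max r s) with h | h
      · exact Or.inl (min_eq_left h)
      · rw [min_eq_right h]
        exact Or.inr ⟨hr2.trans (mono_le x _ _ (le_max_left _ _)),
          hs2.trans (mono_le y _ _ (le_max_right _ _))⟩

/-- If `S` misses the points at distance less than `r` from `x` and contains a point within `s`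
of `y`, the distances to `S` differ by at least `r - s`. -/
theorem sub_le_infDist_sub_infDist {X : Type*} [PseudoMetricSpace X] {A S : Finset X} {x y : X}
    {r s : ℝ} (hS : S ⊆ A) (hx : Disjoint S (A.filter fun a => dist a x < r))
    (hy : ¬ Disjoint S (A.filter fun a => dist a y ≤ s)) :
    r - s ≤ Metric.infDist x (S : Set X) - Metric.infDist y (S : Set X) := by
  obtain ⟨b, hbS, hb⟩ := Finset.not_disjoint_iff.1 hy
  have h1 : Metric.infDist y (S : Set X) ≤ s :=
    (Metric.infDist_le_dist_of_mem (Finset.mem_coe.2 hbS)).trans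
      (by rw [dist_comm]; exact (Finset.mem_filter.1 hb).2)
  have h2 : r ≤ Metric.infDist x (S : Set X) := by
    refine (Metric.le_infDist ⟨b, Finset.mem_coe.2 hbS⟩).2 fun a ha => ?_
    by_contra! hlt
    exact Finset.disjoint_left.1 hx (Finset.mem_coe.1 ha)
      (Finset.mem_filter.2 ⟨hS (Finset.mem_coe.1 ha), by rwa [dist_comm]⟩)
  linarith

theorem disjoint_filter_dist {X : Type*} [PseudoMetricSpace X] (A : Finset X) {x y : X}
    {r s : ℝ} (h : r + s ≤ dist x y) :
    Disjoint (A.filter fun a => dist a x < r) (A.filter fun a => dist a y ≤ s) := by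
  refine Finset.disjoint_left.2 fun a ha hb => ?_
  have h1 := (Finset.mem_filter.1 ha).2
  have h2 := (Finset.mem_filter.1 hb).2
  have := dist_triangle_left x y a
  linarith

/-- Bourgain's scales for a pair of points: the gaps `δ j` between successive threshold radii add
up to half the distance, and `δ j` is detected by any set `S` missing `G j` and hitting `H j`. -/
theorem exists_bourgain_scales {X : Type*} [PseudoMetricSpace X] [DecidableEq X]
    {A : Finset X} {x y : X} (hx : x ∈ A) (hy : y ∈ A) {b : ℝ} (hb : 0 < b) {J : ℕ}
    (hJ : (A.card : ℝ) < b ^ J) :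
    ∃ (δ : ℕ → ℝ) (G H : ℕ → Finset X), (∀ j, 0 ≤ δ j) ∧
      dist x y / 2 ≤ ∑ j ∈ Finset.range J, δ j ∧
      ∀ j, 0 < δ j → G j ⊆ A ∧ H j ⊆ A ∧ Disjoint (G j) (H j) ∧
        ((G j).card : ℝ) ≤ b ^ (j + 1) ∧ b ^ j ≤ ((H j).card : ℝ) ∧
        ∀ S ⊆ A, Disjoint S (G j) → ¬ Disjoint S (H j) →
          δ j ≤ |Metric.infDist x (S : Set X) - Metric.infDist y (S : Set X)| := by
  have hD : 0 ≤ dist x y / 2 := by positivity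
  choose ρ hρ0 hρD hρlt hρle using fun j : ℕ =>
    exists_threshold_radius_pair A x y (pow_pos hb j) hD
  -- The threshold is one point, and an open ball of positive radius already contains its centre.
  have hzero : ρ 0 = 0 := by
    have key : ∀ z ∈ A, ((A.filter fun a => dist a z < ρ 0).card : ℝ) < b ^ 0 → ρ 0 ≤ 0 := by
      intro z hz hlt
      by_contra! hpos
      rw [pow_zero] at hlt
      have : (A.filter fun a => dist a z < ρ 0).card < 1 := by exact_mod_cast hlt
      rw [Nat.lt_one_iff, Finset.card_eq_zero] at this
      have hmem : z ∈ A.filter fun a => dist a z < ρ 0 := Finset.mem_filter.2 ⟨hz, by simpa⟩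
      simp [this] at hmem
    exact le_antisymm ((hρlt 0).elim (key x hx) (key y hy)) (hρ0 0)
  -- No ball holds `b ^ J` points of `A`, so the cutoff is reached.
  have hlast : ρ J = dist x y / 2 := by
    rcases hρle J with h | ⟨h, -⟩
    · exact h
    · have : ((A.filter fun a => dist a x ≤ ρ J).card : ℝ) ≤ A.card := by
        exact_mod_cast Finset.card_filter_le _ _
      linarith
  classical
  -- `G j` is the sparse open ball of radius `ρ (j + 1)`, around whichever point has one; `H j` is
  -- the closed ball of radius `ρ j` around the other point. The cutoff at half the distance makes
  -- them disjoint.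
  set side : ℕ → Prop := fun j => ((A.filter fun a => dist a x < ρ (j + 1)).card : ℝ) < b ^ (j + 1)
  refine ⟨fun j => max 0 (ρ (j + 1) - ρ j),
    fun j => if side j then A.filter fun a => dist a x < ρ (j + 1)
      else A.filter fun a => dist a y < ρ (j + 1),
    fun j => if side j then A.filter fun a => dist a y ≤ ρ j else A.filter fun a => dist a x ≤ ρ j,
    fun j => le_max_left _ _, ?_, ?_⟩
  · calc dist x y / 2 = ∑ j ∈ Finset.range J, (ρ (j + 1) - ρ j) := by
          rw [Finset.sum_range_sub, hlast, hzero, sub_zero]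
      _ ≤ _ := Finset.sum_le_sum fun j _ => le_max_right _ _
  · intro j hj
    have hlt : ρ j < ρ (j + 1) := by
      by_contra! h
      simp [h] at hj
    have hmax : max 0 (ρ (j + 1) - ρ j) = ρ (j + 1) - ρ j := max_eq_right (by linarith)
    have hsum : ρ (j + 1) + ρ j ≤ dist x y := by linarith [hρD j, hρD (j + 1)]
    have hH : b ^ j ≤ ((A.filter fun a => dist a x ≤ ρ j).card : ℝ) ∧
        b ^ j ≤ ((A.filter fun a => dist a y ≤ ρ j).card : ℝ) := by
      rcases hρle j with h | h
      · linarith [hρD (j + 1)]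
      · exact h
    simp only [hmax]
    by_cases hside : side j
    · simp only [if_pos hside]
      exact ⟨Finset.filter_subset _ _, Finset.filter_subset _ _, disjoint_filter_dist A hsum,
        le_of_lt hside, hH.2, fun S hS h1 h2 =>
          (sub_le_infDist_sub_infDist hS h1 h2).trans (le_abs_self _)⟩
    · simp only [if_neg hside]
      refine ⟨Finset.filter_subset _ _, Finset.filter_subset _ _,
        disjoint_filter_dist A (by rwa [dist_comm]), ((hρlt (j + 1)).resolve_left hside).le,
        hH.1, fun S hS h1 h2 => ?_⟩
      rw [abs_sub_comm]
      exact (sub_le_infDist_sub_infDist hS h1 h2).trans (le_abs_self _)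

/-- The missing probability `(3/4) ^ (3 / (3/2) ^ (j + 1))` is suited to the scale `(3/2) ^ j`. -/
theorem hit_probability_ge {j g h : ℕ} (hg : (g : ℝ) ≤ (3 / 2 : ℝ) ^ (j + 1))
    (hh : (3 / 2 : ℝ) ^ j ≤ h) :
    (189 / 1024 : ℝ) ≤ ((3 / 4 : ℝ) ^ (3 / (3 / 2 : ℝ) ^ (j + 1) : ℝ)) ^ g *
      (1 - ((3 / 4 : ℝ) ^ (3 / (3 / 2 : ℝ) ^ (j + 1) : ℝ)) ^ h) := by
  have hb : (0 : ℝ) < (3 / 2 : ℝ) ^ (j + 1) := by positivity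
  -- The exponent of `3/4` is at most `3` for `g`, and at least `3 / (3/2) = 2` for `h`.
  have h1 : (27 / 64 : ℝ) ≤ ((3 / 4 : ℝ) ^ (3 / (3 / 2 : ℝ) ^ (j + 1) : ℝ)) ^ g := by
    rw [← Real.rpow_natCast, ← Real.rpow_mul (by norm_num)]
    calc (27 / 64 : ℝ) = (3 / 4 : ℝ) ^ (3 : ℝ) := by norm_num
      _ ≤ _ := by
        refine Real.rpow_le_rpow_of_exponent_ge (by norm_num) (by norm_num) ?_
        rw [div_mul_eq_mul_div, div_le_iff₀ hb]
        linarith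
  have h2 : ((3 / 4 : ℝ) ^ (3 / (3 / 2 : ℝ) ^ (j + 1) : ℝ)) ^ h ≤ 9 / 16 := by
    rw [← Real.rpow_natCast, ← Real.rpow_mul (by norm_num)]
    calc _ ≤ (3 / 4 : ℝ) ^ (2 : ℝ) := by
          refine Real.rpow_le_rpow_of_exponent_ge (by norm_num) (by norm_num) ?_
          rw [div_mul_eq_mul_div, le_div_iff₀ hb, pow_succ]
          linarith
      _ = 9 / 16 := by norm_num
  calc (189 / 1024 : ℝ) = 27 / 64 * (7 / 16) := by norm_num
    _ ≤ _ := mul_le_mul h1 (by linarith) (by norm_num) (by positivity)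

theorem lipschitzWith_signedSum_infDist {X : Type*} [PseudoMetricSpace X] (J : ℕ)
    (σ : Finset ℕ) (S : ℕ → Set X) :
    LipschitzWith (J : ℝ≥0)
      fun x => signedSum (Finset.range J) σ fun j => Metric.infDist x (S j) := by
  refine LipschitzWith.of_dist_le_mul fun x y => ?_
  rw [Real.dist_eq, signedSum, signedSum, ← Finset.sum_sub_distrib]
  refine (Finset.abs_sum_le_sum_abs _ _).trans ?_
  calc _ ≤ ∑ j ∈ Finset.range J, dist x y := by
        refine Finset.sum_le_sum fun j _ => ?_
        have h := (Metric.lipschitz_infDist_pt (S j)).dist_le_mul x y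
        rw [Real.dist_eq, NNReal.coe_one, one_mul] at h
        split_ifs
        · exact h
        · rwa [neg_sub_neg, abs_sub_comm]
    _ = _ := by simp

/-- One coordinate of the embedding: a `2 n`-Lipschitz function separating at least `0.054` of the
given pairs. -/
theorem exists_separating_function {X : Type*} [MetricSpace X] {A : Finset X} {n : ℕ}
    (hn : 1 ≤ n) (hA : A.card ≤ 2 ^ n) (Q : Finset (X × X)) (hQ : Q ⊆ A.offDiag) :
    ∃ F : X → ℝ, LipschitzWith (2 * n : ℝ≥0) F ∧ (0.054 : ℝ) * Q.card ≤
      (Q.filter fun k => dist k.1 k.2 ^ 2 / (40000 * n) ≤ (F k.1 - F k.2) ^ 2).card := by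
  classical
  -- Two steps of ratio `3/2` multiply by `9/4 > 2`, so `2n` scales exhaust `2 ^ n` points.
  set J := 2 * n with hJ
  have hn0 : (0 : ℝ) < n := by exact_mod_cast hn
  have hAJ : (A.card : ℝ) < (3 / 2 : ℝ) ^ J := by
    calc (A.card : ℝ) ≤ 2 ^ n := by exact_mod_cast hA
      _ < (9 / 4 : ℝ) ^ n := pow_lt_pow_left₀ (by norm_num) (by norm_num) (by omega)
      _ = (3 / 2 : ℝ) ^ J := by rw [hJ, pow_mul]; norm_num
  have hscale : ∀ k : X × X, ∃ (δ : ℕ → ℝ) (G H : ℕ → Finset X), k ∈ Q → (∀ j, 0 ≤ δ j) ∧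
      dist k.1 k.2 / 2 ≤ ∑ j ∈ Finset.range J, δ j ∧
      ∀ j, 0 < δ j → G j ⊆ A ∧ H j ⊆ A ∧ Disjoint (G j) (H j) ∧
        ((G j).card : ℝ) ≤ (3 / 2 : ℝ) ^ (j + 1) ∧ (3 / 2 : ℝ) ^ j ≤ ((H j).card : ℝ) ∧
        ∀ S ⊆ A, Disjoint S (G j) → ¬ Disjoint S (H j) →
          δ j ≤ |Metric.infDist k.1 (S : Set X) - Metric.infDist k.2 (S : Set X)| := by
    intro k
    by_cases hk : k ∈ Q
    · obtain ⟨h1, h2, -⟩ := Finset.mem_offDiag.1 (hQ hk)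
      obtain ⟨δ, G, H, h⟩ := exists_bourgain_scales h1 h2 (by norm_num : (0 : ℝ) < 3 / 2) hAJ
      exact ⟨δ, G, H, fun _ => h⟩
    · exact ⟨0, fun _ => ∅, fun _ => ∅, fun h => absurd h hk⟩
  choose δ G H hδ using hscale
  set D : X × X → ℝ := fun k => ∑ j ∈ Finset.range J, δ k j ^ 2 with hDdef
  have hDlow : ∀ k ∈ Q, dist k.1 k.2 ^ 2 / (8 * n) ≤ D k := by
    intro k hk
    obtain ⟨-, h2, -⟩ := hδ k hk
    have hcs := sq_sum_le_card_mul_sum_sq (s := Finset.range J) (f := δ k)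
    rw [Finset.card_range, hJ] at hcs
    push_cast at hcs
    have hsq : (dist k.1 k.2 / 2) ^ 2 ≤ (∑ j ∈ Finset.range J, δ k j) ^ 2 :=
      pow_le_pow_left₀ (by positivity) h2 2
    rw [div_le_iff₀ (by positivity)]
    simp only [hDdef]
    nlinarith
  have hDpos : ∀ k ∈ Q, 0 < D k := by
    intro k hk
    have hne := (Finset.mem_offDiag.1 (hQ hk)).2.2
    have : 0 < dist k.1 k.2 := dist_pos.2 hne
    exact lt_of_lt_of_le (by positivity) (hDlow k hk)
  -- The weights `δ² / D` add up to `1` over the scales for each pair, so the scalewise bounds add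
  -- up to a bound proportional to `Q.card`.
  have hsets : ∀ j : ℕ, ∃ S ⊆ A, (189 / 1024 : ℝ) * ∑ k ∈ Q, δ k j ^ 2 / D k ≤
      ∑ k ∈ Q, if Disjoint S (G k j) ∧ ¬ Disjoint S (H k j) then δ k j ^ 2 / D k else 0 := by
    intro j
    have hexp : (0 : ℝ) < 3 / (3 / 2 : ℝ) ^ (j + 1) := by positivity
    refine exists_subset_hitting A Q (fun k => G k j) (fun k => H k j) (fun k => δ k j ^ 2 / D k)
      (s := (3 / 4 : ℝ) ^ (3 / (3 / 2 : ℝ) ^ (j + 1) : ℝ)) (by positivity)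
      (Real.rpow_lt_one (by norm_num) (by norm_num) hexp)
      (fun k hk => div_nonneg (sq_nonneg _) (hDpos k hk).le) fun k hk hw => ?_
    obtain ⟨h1, -, h3⟩ := hδ k hk
    have hpos : 0 < δ k j := by
      refine lt_of_le_of_ne (h1 j) fun h0 => ?_
      simp [← h0] at hw
    obtain ⟨hG, hH, hGH, hgc, hhc, -⟩ := h3 j hpos
    exact ⟨hG, hH, hGH, hit_probability_ge hgc hhc⟩
  choose S hSA hS using hsets
  set t : X × X → ℕ → ℝ := fun k j =>
    Metric.infDist k.1 (S j : Set X) - Metric.infDist k.2 (S j : Set X) with ht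
  set Y : X × X → ℝ := fun k => (∑ j ∈ Finset.range J, t k j ^ 2) / D k with hY
  set Z : X × X → ℝ := fun k => ∑ j ∈ Finset.range J,
    if Disjoint (S j) (G k j) ∧ ¬ Disjoint (S j) (H k j) then δ k j ^ 2 / D k else 0 with hZ
  have hZ1 : ∀ k ∈ Q, Z k ≤ 1 := by
    intro k hk
    calc Z k ≤ ∑ j ∈ Finset.range J, δ k j ^ 2 / D k := by
          refine Finset.sum_le_sum fun j _ => ?_
          split_ifs
          · exact le_rfl
          · exact div_nonneg (sq_nonneg _) (hDpos k hk).le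
      _ = 1 := by rw [← Finset.sum_div]; exact div_self (hDpos k hk).ne'
  have hZY : ∀ k ∈ Q, Z k ≤ Y k := by
    intro k hk
    simp only [hY, hZ]
    rw [Finset.sum_div]
    refine Finset.sum_le_sum fun j _ => ?_
    split_ifs with hc
    · refine div_le_div_of_nonneg_right ?_ (hDpos k hk).le
      obtain ⟨h1, -, h3⟩ := hδ k hk
      rcases (h1 j).eq_or_lt with h0 | h0
      · rw [← h0, zero_pow two_ne_zero]
        exact sq_nonneg _
      · rw [← sq_abs (t k j)]
        exact pow_le_pow_left₀ h0.le ((h3 j h0).2.2.2.2.2 (S j) (hSA j) hc.1 hc.2) 2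
    · exact div_nonneg (sq_nonneg _) (hDpos k hk).le
  have hZsum : (189 / 1024 : ℝ) * Q.card ≤ ∑ k ∈ Q, Z k := by
    have h := Finset.sum_le_sum fun j (_ : j ∈ Finset.range J) => hS j
    rw [← Finset.mul_sum, Finset.sum_comm, Finset.sum_comm (t := Q)] at h
    refine le_trans (le_of_eq ?_) h
    congr 1
    rw [Finset.card_eq_sum_ones, Nat.cast_sum]
    refine Finset.sum_congr rfl fun k hk => ?_
    rw [← Finset.sum_div, Nat.cast_one]
    exact (div_self (hDpos k hk).ne').symm
  -- Since `Z ≤ 1` has average at least `189/1024 > 0.18 + 0.0045`, Markov's argument puts `0.18` of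
  -- the pairs in `R`; the signs keep `3/10` of these, hence `0.054`.
  set R := Q.filter fun k => 0.0045 ≤ Z k with hR
  have hRQ : R ⊆ Q := Finset.filter_subset _ _
  have hRcard : (0.18 : ℝ) * Q.card ≤ R.card := by
    have : ∑ k ∈ Q, Z k ≤ ∑ k ∈ Q, (0.0045 + if 0.0045 ≤ Z k then (1 : ℝ) else 0) := by
      refine Finset.sum_le_sum fun k hk => ?_
      split_ifs with hc
      · linarith [hZ1 k hk]
      · linarith
    rw [Finset.sum_add_distrib, Finset.sum_boole, Finset.sum_const, nsmul_eq_mul, ← hR] at this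
    have hc : (0 : ℝ) ≤ Q.card := Nat.cast_nonneg _
    linarith
  have hV : ∀ k ∈ R, 0.0045 * D k ≤ ∑ j ∈ Finset.range J, t k j ^ 2 := by
    intro k hk
    obtain ⟨hkQ, hkZ⟩ := Finset.mem_filter.1 hk
    exact (le_div_iff₀ (hDpos k hkQ)).1 (hkZ.trans (hZY k hkQ))
  obtain ⟨σ, -, hσ⟩ := exists_signs (Finset.range J) R t fun k hk =>
    lt_of_lt_of_le (mul_pos (by norm_num) (hDpos k (hRQ hk))) (hV k hk)
  refine ⟨fun x => signedSum (Finset.range J) σ fun j => Metric.infDist x (S j : Set X), ?_, ?_⟩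
  · simpa [hJ] using lipschitzWith_signedSum_infDist J σ fun j => (S j : Set X)
  · have hsub : (R.filter fun k => (∑ j ∈ Finset.range J, t k j ^ 2) / 20 ≤
        signedSum (Finset.range J) σ (t k) ^ 2) ⊆ Q.filter fun k =>
        dist k.1 k.2 ^ 2 / (40000 * n) ≤
        ((signedSum (Finset.range J) σ fun j => Metric.infDist k.1 (S j : Set X)) -
          signedSum (Finset.range J) σ fun j => Metric.infDist k.2 (S j : Set X)) ^ 2 := by
      intro k hk
      obtain ⟨hkR, hkσ⟩ := Finset.mem_filter.1 hk
      refine Finset.mem_filter.2 ⟨hRQ hkR, ?_⟩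
      have heq : signedSum (Finset.range J) σ (t k) =
          (signedSum (Finset.range J) σ fun j => Metric.infDist k.1 (S j : Set X)) -
          signedSum (Finset.range J) σ fun j => Metric.infDist k.2 (S j : Set X) := by
        simp only [signedSum, ht, ← Finset.sum_sub_distrib]
        refine Finset.sum_congr rfl fun j _ => ?_
        split_ifs <;> ring
      rw [← heq]
      have h1 := hDlow k (hRQ hkR)
      have h2 := hV k hkR
      -- The losses `0.0045` and `1/20` multiply to more than `1/5000`.
      have h3 : dist k.1 k.2 ^ 2 / (40000 * n) = dist k.1 k.2 ^ 2 / (8 * n) / 5000 := by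
        field_simp
        ring
      have h4 : 0 ≤ dist k.1 k.2 ^ 2 / (8 * n) := by positivity
      rw [h3]
      linarith
    have hle : ((R.filter fun k => (∑ j ∈ Finset.range J, t k j ^ 2) / 20 ≤
        signedSum (Finset.range J) σ (t k) ^ 2).card : ℝ) ≤ _ := Nat.cast_le.2
          (Finset.card_le_card hsub)
    refine le_trans ?_ hle
    linarith

/-- A finite set of `2 ^ n` points is embedded into `ℓ_∞^{26 n}` with distortion of order
`n ^ (3/2)`. -/
theorem exists_embedding {X : Type*} [MetricSpace X] {A : Finset X} {n : ℕ}
    (hn : 1 ≤ n) (hA : A.card ≤ 2 ^ n) :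
    ∃ F : X → (Fin (26 * n) → ℝ), LipschitzWith (2 * n : ℝ≥0) F ∧
      ∀ x ∈ A, ∀ y ∈ A, dist x y ≤ 200 * √n * dist (F x) (F y) := by
  classical
  have hn0 : (0 : ℝ) < n := by exact_mod_cast hn
  obtain ⟨φ, hφ⟩ := exists_greedy_cover
    (Φ := {F : X → ℝ // LipschitzWith (2 * n : ℝ≥0) F})
    (fun F (k : X × X) => dist k.1 k.2 ^ 2 / (40000 * n) ≤ (F.1 k.1 - F.1 k.2) ^ 2)
    A.offDiag (q := 0.946) (by norm_num) (fun Q hQ => by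
      obtain ⟨F, hF, h⟩ := exists_separating_function hn hA Q hQ
      refine ⟨⟨F, hF⟩, ?_⟩
      norm_num at h ⊢
      convert h using 2) (26 * n)
  have hcard : (A.offDiag.card : ℝ) ≤ 4 ^ n := by
    have h1 : A.offDiag.card ≤ 2 ^ n * 2 ^ n := by
      rw [Finset.offDiag_card]
      exact (Nat.sub_le _ _).trans (Nat.mul_le_mul hA hA)
    rw [← mul_pow] at h1
    exact_mod_cast h1
  -- The factor `26` is chosen so that `4 · 0.946 ^ 26 < 1`.
  have hlt : (0.946 : ℝ) ^ (26 * n) * A.offDiag.card < 1 := by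
    calc (0.946 : ℝ) ^ (26 * n) * A.offDiag.card ≤ (0.946 ^ 26) ^ n * 4 ^ n := by
          rw [← pow_mul]
          exact mul_le_mul_of_nonneg_left hcard (by positivity)
      _ = (0.946 ^ 26 * 4) ^ n := (mul_pow _ _ _).symm
      _ < 1 := pow_lt_one₀ (by positivity) (by norm_num) (by omega)
  have hempty := hφ.trans_lt hlt
  rw [Nat.cast_lt_one, Finset.card_eq_zero] at hempty
  refine ⟨fun x i => (φ i).1 x, ?_, fun x hx y hy => ?_⟩
  · refine LipschitzWith.of_dist_le_mul fun x y => ?_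
    exact (dist_pi_le_iff (by positivity)).2 fun i => (φ i).2.dist_le_mul x y
  · rcases eq_or_ne x y with rfl | hne
    · simp
    have hmem : (x, y) ∈ A.offDiag := Finset.mem_offDiag.2 ⟨hx, hy, hne⟩
    have hex : ∃ i, dist x y ^ 2 / (40000 * n) ≤ ((φ i).1 x - (φ i).1 y) ^ 2 := by
      by_contra! hcon
      have : (x, y) ∈ (∅ : Finset (X × X)) := by
        rw [← hempty]
        exact Finset.mem_filter.2 ⟨hmem, fun i => not_le.2 (hcon i)⟩
      simp at this
    obtain ⟨i, hi⟩ := hex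
    have hd : |(φ i).1 x - (φ i).1 y| ≤ dist (fun i => (φ i).1 x) (fun i => (φ i).1 y) :=
      dist_le_pi_dist (fun i => (φ i).1 x) (fun i => (φ i).1 y) i
    refine le_trans ?_ (mul_le_mul_of_nonneg_left hd (by positivity))
    refine (sq_le_sq₀ dist_nonneg (by positivity)).1 ?_
    rw [mul_pow, mul_pow, Real.sq_sqrt hn0.le, sq_abs]
    rw [div_le_iff₀ (by positivity)] at hi
    linarith

/-! ### Lipschitz extension from a finite subset of `ℓ_∞^m` -/

open MeasureTheory in
/-- The averages of a bounded function over two nested sets are close if their measures are. -/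
theorem norm_setAverage_sub_le {Y E : Type*} [MeasurableSpace Y] [NormedAddCommGroup E]
    [NormedSpace ℝ E] [CompleteSpace E] {μ : Measure Y} {B Q : Set Y} {g : Y → E} {c : E} {R : ℝ}
    (hBQ : B ⊆ Q) (hB : MeasurableSet B) (hQ : MeasurableSet Q) (hQfin : μ Q ≠ ⊤)
    (hB0 : 0 < μ.real B) (hg : IntegrableOn g Q μ) (hR : ∀ z ∈ Q, ‖g z - c‖ ≤ R) :
    ‖⨍ z in B, g z ∂μ - ⨍ z in Q, g z ∂μ‖ ≤ 2 * R * (1 - μ.real B / μ.real Q) := by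
  have hle : μ.real B ≤ μ.real Q := measureReal_mono hBQ hQfin
  have hQ0 : 0 < μ.real Q := hB0.trans_le hle
  have hBfin : μ B ≠ ⊤ := measure_ne_top_of_subset hBQ hQfin
  set h : Y → E := fun z => g z - c with hh
  have hcQ : IntegrableOn (fun _ => c) Q μ := integrableOn_const hQfin
  have hint : IntegrableOn h Q μ := hg.sub hcQ
  have havg : ∀ S ⊆ Q, 0 < μ.real S →
      ⨍ z in S, g z ∂μ = (μ.real S)⁻¹ • ∫ z in S, h z ∂μ + c := by
    intro S hS hS0
    have hsub : ∫ z in S, h z ∂μ = ∫ z in S, g z ∂μ - μ.real S • c := by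
      rw [hh, integral_sub (hg.mono_set hS) (hcQ.mono_set hS), setIntegral_const]
    rw [setAverage_eq, hsub, smul_sub, smul_smul, inv_mul_cancel₀ hS0.ne', one_smul,
      sub_add_cancel]
  have hsplit : ∫ z in Q, h z ∂μ = ∫ z in B, h z ∂μ + ∫ z in Q \ B, h z ∂μ := by
    rw [← setIntegral_union Set.disjoint_sdiff_right (hQ.diff hB) (hint.mono_set hBQ)
      (hint.mono_set Set.sdiff_subset), Set.union_sdiff_cancel hBQ]
  have h1 : ‖∫ z in B, h z ∂μ‖ ≤ R * μ.real B :=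
    norm_setIntegral_le_of_norm_le_const hBfin.lt_top fun z hz => hR z (hBQ hz)
  have h2 : ‖∫ z in Q \ B, h z ∂μ‖ ≤ R * (μ.real Q - μ.real B) := by
    rw [← measureReal_sdiff hBQ hB hQfin]
    exact norm_setIntegral_le_of_norm_le_const
      (measure_ne_top_of_subset Set.sdiff_subset hQfin).lt_top fun z hz => hR z hz.1
  have hinv : 0 ≤ (μ.real B)⁻¹ - (μ.real Q)⁻¹ := sub_nonneg.2 (inv_anti₀ hB0 hle)
  -- After centring at `c`, each of the two terms has norm at most `R (1 - μ B / μ Q)`.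
  have heq : ⨍ z in B, g z ∂μ - ⨍ z in Q, g z ∂μ =
      ((μ.real B)⁻¹ - (μ.real Q)⁻¹) • ∫ z in B, h z ∂μ -
        (μ.real Q)⁻¹ • ∫ z in Q \ B, h z ∂μ := by
    rw [havg B hBQ hB0, havg Q subset_rfl hQ0, hsplit, sub_smul, smul_add]
    abel
  rw [heq]
  refine (norm_sub_le _ _).trans ?_
  rw [norm_smul, norm_smul, Real.norm_of_nonneg hinv, Real.norm_of_nonneg (inv_nonneg.2 hQ0.le)]
  calc _ ≤ ((μ.real B)⁻¹ - (μ.real Q)⁻¹) * (R * μ.real B) +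
        (μ.real Q)⁻¹ * (R * (μ.real Q - μ.real B)) :=
        add_le_add (mul_le_mul_of_nonneg_left h1 hinv)
          (mul_le_mul_of_nonneg_left h2 (inv_nonneg.2 hQ0.le))
    _ = 2 * R * (1 - μ.real B / μ.real Q) := by
        field_simp
        ring

/-- The relative volume of the gap between two cubes in dimension `m`. -/
theorem one_sub_volume_closedBall_div_le {m : ℕ} (y y' : Fin m → ℝ) {r q : ℝ} (hr : 0 ≤ r)
    (hq : 0 < q) :
    1 - MeasureTheory.volume.real (Metric.closedBall y r) /
      MeasureTheory.volume.real (Metric.closedBall y' q) ≤ m * ((q - r) / q) := by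
  rw [MeasureTheory.measureReal_def, MeasureTheory.measureReal_def,
    Real.volume_pi_closedBall y hr, Real.volume_pi_closedBall y' hq.le,
    ENNReal.toReal_ofReal (by positivity), ENNReal.toReal_ofReal (by positivity), ← div_pow,
    mul_div_mul_left _ _ two_ne_zero, Fintype.card_fin]
  have h0 : 0 ≤ r / q := by positivity
  -- Bernoulli's inequality for the volume ratio `(r / q) ^ m`; this is where the dimension enters
  -- the extension constant.
  have hb := one_add_mul_le_pow (a := r / q - 1) (by linarith) m
  have : (q - r) / q = 1 - r / q := by rw [sub_div, div_self hq.ne']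
  rw [this]
  rw [add_sub_cancel] at hb
  linarith

open MeasureTheory in
/-- A Lipschitz map from a finite subset of `ℓ_∞^m` to a Banach space extends to the whole space
with its Lipschitz constant enlarged by a factor `40 m`: at `y` one averages the values at the
nearest points over the cube centred at `y` whose radius is the distance to the subset. -/
theorem exists_lipschitz_extension {E : Type*} [NormedAddCommGroup E] [NormedSpace ℝ E]
    [CompleteSpace E] {m : ℕ} (hm : 1 ≤ m) (p : ℕ → Fin m → ℝ) (v : ℕ → E) (N : ℕ) (L : ℝ≥0)
    (hL : ∀ i ≤ N, ∀ k ≤ N, dist (v i) (v k) ≤ L * dist (p i) (p k)) :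
    ∃ M : (Fin m → ℝ) → E, LipschitzWith (40 * m * L) M ∧ ∀ i ≤ N, M (p i) = v i := by
  set π : (Fin m → ℝ) → ℕ := fun z => SimpleFunc.nearestPtInd p N z with hπ
  have hπN : ∀ z, π z ≤ N := fun z => SimpleFunc.nearestPtInd_le p N z
  set r : (Fin m → ℝ) → ℝ := fun z => dist (p (π z)) z with hr
  have hr0 : ∀ z, 0 ≤ r z := fun z => dist_nonneg
  have hrmin : ∀ z, ∀ k ≤ N, r z ≤ dist (p k) z := by
    intro z k hk
    have := SimpleFunc.edist_nearestPt_le p z hk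
    rwa [edist_dist, edist_dist, ENNReal.ofReal_le_ofReal_iff dist_nonneg] at this
  have hrlip : ∀ z w, r z ≤ r w + dist w z := fun z w =>
    (hrmin z _ (hπN w)).trans (dist_triangle _ _ _)
  have hL0 : (0 : ℝ) ≤ L := L.2
  set g : (Fin m → ℝ) → E := fun z => v (π z) with hg
  have hgint : ∀ y q, IntegrableOn g (Metric.closedBall y q) volume := by
    intro y q
    have : IsFiniteMeasure (volume.restrict (Metric.closedBall y q)) :=
      ⟨by rw [Measure.restrict_apply_univ]; exact measure_closedBall_lt_top⟩
    exact ((SimpleFunc.nearestPtInd p N).map v).integrable_of_isFiniteMeasure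
  have hgdist : ∀ z w, dist (g z) (g w) ≤ L * (r z + dist z w + r w) := by
    intro z w
    refine (hL _ (hπN z) _ (hπN w)).trans (mul_le_mul_of_nonneg_left ?_ hL0)
    have h1 := dist_triangle4 (p (π z)) z w (p (π w))
    rwa [dist_comm w] at h1
  set M : (Fin m → ℝ) → E := fun y =>
    if r y = 0 then g y else ⨍ z in Metric.closedBall y (r y), g z with hM
  have hMzero : ∀ y, r y = 0 → M y = g y := fun y h => if_pos h
  have hMpos : ∀ y, r y ≠ 0 → M y = ⨍ z in Metric.closedBall y (r y), g z := fun y h => if_neg h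
  have hvolpos : ∀ y, 0 < r y → 0 < volume.real (Metric.closedBall y (r y)) := by
    intro y hy
    rw [measureReal_def, Real.volume_pi_closedBall y hy.le, ENNReal.toReal_ofReal (by positivity)]
    positivity
  have hm1 : (1 : ℝ) ≤ m := by exact_mod_cast hm
  -- one of the two points belongs to the finite set
  have hcase : ∀ y y', r y' = 0 → dist (M y) (M y') ≤ 40 * m * L * dist y y' := by
    intro y y' h'
    have hry : r y ≤ dist y y' := by
      have := hrlip y y'
      rw [h', dist_comm] at this
      linarith
    have hgoal : dist (M y) (g y') ≤ L * (4 * dist y y') := by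
      rcases (hr0 y).eq_or_lt with h0 | h0
      · rw [hMzero y h0.symm]
        refine (hgdist y y').trans (mul_le_mul_of_nonneg_left ?_ hL0)
        rw [← h0, h']
        linarith [dist_nonneg (x := y) (y := y')]
      · rw [hMpos y h0.ne', ← Metric.mem_closedBall]
        refine (convex_closedBall (g y') _).set_average_mem Metric.isClosed_closedBall ?_ ?_ ?_
          (hgint y (r y))
        · intro h
          have := hvolpos y h0
          rw [measureReal_def, h] at this
          simp at this
        · exact measure_closedBall_lt_top.ne
        · refine (ae_restrict_iff' Metric.isClosed_closedBall.measurableSet).2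
            (Filter.Eventually.of_forall fun z hz => ?_)
          rw [Metric.mem_closedBall] at hz ⊢
          refine (hgdist z y').trans (mul_le_mul_of_nonneg_left ?_ hL0)
          have h1 := hrlip z y
          rw [dist_comm] at h1
          have h2 := dist_triangle z y y'
          linarith
    rw [hMzero y' h']
    refine hgoal.trans ?_
    have hd : 0 ≤ L * dist y y' := mul_nonneg hL0 dist_nonneg
    nlinarith
  refine ⟨M, LipschitzWith.of_dist_le_mul fun y y' => ?_, fun i hi => ?_⟩
  · push_cast
    rcases (hr0 y').eq_or_lt with h0' | h0'
    · exact hcase y y' h0'.symm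
    rcases (hr0 y).eq_or_lt with h0 | h0
    · rw [dist_comm, dist_comm y]
      exact hcase y' y h0.symm
    set s := dist y y' with hs
    have hs0 : 0 ≤ s := dist_nonneg
    -- The cube of radius `q` about `y'` contains both averaging cubes, and the two radius defects
    -- `q - r y` and `q - r y'` total at most `5 s`.
    set q := r y + 2 * s with hq
    have hq0 : 0 < q := by linarith
    have hr' : r y' ≤ r y + s := hrlip y' y
    have hr'' : r y ≤ r y' + s := by rw [hs, dist_comm]; exact hrlip y y'
    have hsub : Metric.closedBall y (r y) ⊆ Metric.closedBall y' q :=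
      Metric.closedBall_subset_closedBall' (by linarith)
    have hsub' : Metric.closedBall y' (r y') ⊆ Metric.closedBall y' q :=
      Metric.closedBall_subset_closedBall (by linarith)
    have hR : ∀ z ∈ Metric.closedBall y' q, ‖g z - g y'‖ ≤ 4 * L * q := by
      intro z hz
      rw [Metric.mem_closedBall] at hz
      rw [← dist_eq_norm]
      have h1 := hrlip z y'
      rw [dist_comm] at h1
      calc _ ≤ L * (r z + dist z y' + r y') := hgdist z y'
        _ ≤ L * (4 * q) := mul_le_mul_of_nonneg_left (by linarith) hL0
        _ = 4 * L * q := by ring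
    have hmeas : ∀ w a, MeasurableSet (Metric.closedBall (w : Fin m → ℝ) a) :=
      fun w a => Metric.isClosed_closedBall.measurableSet
    have hA := norm_setAverage_sub_le (μ := volume) hsub (hmeas _ _) (hmeas _ _)
      measure_closedBall_lt_top.ne (hvolpos y h0) (hgint y' q) hR
    have hA' := norm_setAverage_sub_le (μ := volume) hsub' (hmeas _ _) (hmeas _ _)
      measure_closedBall_lt_top.ne (hvolpos y' h0') (hgint y' q) hR
    have hv := one_sub_volume_closedBall_div_le y y' h0.le hq0
    have hv' := one_sub_volume_closedBall_div_le y' y' h0'.le hq0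
    have hRn : 0 ≤ 2 * (4 * L * q) := by positivity
    rw [hMpos y h0.ne', hMpos y' h0'.ne']
    refine (dist_triangle_right _ _ (⨍ z in Metric.closedBall y' q, g z)).trans ?_
    rw [dist_eq_norm, dist_eq_norm]
    have e1 := hA.trans (mul_le_mul_of_nonneg_left hv hRn)
    have e2 := hA'.trans (mul_le_mul_of_nonneg_left hv' hRn)
    have e3 : 2 * (4 * L * q) * (m * ((q - r y) / q)) + 2 * (4 * L * q) * (m * ((q - r y') / q)) =
        8 * m * L * ((q - r y) + (q - r y')) := by
      field_simp
      ring
    refine (add_le_add e1 e2).trans ?_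
    rw [e3]
    calc 8 * m * L * ((q - r y) + (q - r y')) ≤ 8 * m * L * (5 * s) :=
          mul_le_mul_of_nonneg_left (by linarith) (by positivity)
      _ = 40 * m * L * s := by ring
  · have h0 : r (p i) = 0 := le_antisymm (by simpa using hrmin (p i) i hi) (hr0 _)
    rw [hMzero _ h0]
    -- The nearest index may differ from `i` if points repeat; `hL` then forces equal values.
    refine dist_le_zero.1 ((hL _ (hπN _) i hi).trans_eq ?_)
    have : dist (p (π (p i))) (p i) = 0 := h0
    rw [this, mul_zero]

/-! ### Entropy numbers and the main result -/

theorem entropyNumber_nonneg {X : Type u} [PseudoMetricSpace X] (n : ℕ) (K : Set X) :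
    0 ≤ entropyNumber n K :=
  Real.sInf_nonneg fun _ h => h.1.le

/-- A compact set whose `n`-th entropy number vanishes has at most `2 ^ n` points. -/
theorem card_le_of_entropyNumber_eq_zero {X : Type u} [NormedAddCommGroup X] {K : Set X}
    (hK : IsCompact K) {n : ℕ} (h : entropyNumber n K = 0) (T : Finset X) (hT : (T : Set X) ⊆ K) :
    T.card ≤ 2 ^ n := by
  classical
  by_contra! hcard
  have hpos : 0 < 2 ^ n := by positivity
  have hne : T.offDiag.Nonempty := by
    obtain ⟨x, hx, y, hy, hxy⟩ := Finset.one_lt_card.1 (by omega : 1 < T.card)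
    exact ⟨(x, y), Finset.mem_offDiag.2 ⟨hx, hy, hxy⟩⟩
  obtain ⟨k, hk, hmin⟩ := T.offDiag.exists_min_image (fun k => dist k.1 k.2) hne
  have hη : 0 < dist k.1 k.2 := dist_pos.2 (Finset.mem_offDiag.1 hk).2.2
  set s := {ε : ℝ | 0 < ε ∧ ∃ c : Fin (2 ^ n) → X, K ⊆ ⋃ i, Metric.closedBall (c i) ε} with hs
  have hsne : s.Nonempty := by
    obtain ⟨R, hR⟩ := hK.isBounded.subset_closedBall (0 : X)
    refine ⟨max R 1, by positivity, fun _ => 0, fun x hx => Set.mem_iUnion.2 ⟨⟨0, hpos⟩, ?_⟩⟩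
    exact Metric.closedBall_subset_closedBall (le_max_left _ _) (hR hx)
  -- Two points in one ball of radius below a third of the minimal separation would be too close;
  -- pigeonhole provides them.
  obtain ⟨ε, ⟨-, c, hc⟩, hlt⟩ := exists_lt_of_csInf_lt hsne
    (show sInf s < dist k.1 k.2 / 3 by
      have : sInf s = 0 := h
      rw [this]
      positivity)
  choose! f hf using fun x (hx : x ∈ K) => Set.mem_iUnion.1 (hc hx)
  obtain ⟨x, hx, y, hy, hxy, hfxy⟩ := Finset.exists_ne_map_eq_of_card_lt_of_maps_to
    (t := (Finset.univ : Finset (Fin (2 ^ n)))) (by simpa using hcard)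
    (f := f) (fun _ _ => Finset.mem_univ _)
  have h1 := Metric.mem_closedBall.1 (hf x (hT hx))
  have h2 := Metric.mem_closedBall.1 (hf y (hT hy))
  have h3 := hmin (x, y) (Finset.mem_offDiag.2 ⟨hx, hy, hxy⟩)
  rw [← hfxy] at h2
  have h4 := dist_triangle_right x y (c (f x))
  simp only at h3
  linarith

/-- Nearly optimal nets for the entropy number. -/
theorem exists_net_entropyNumber {X : Type u} [NormedAddCommGroup X] {K : Set X}
    (hK : IsCompact K) (n : ℕ) :
    ∃ A : Finset X, A.Nonempty ∧ A.card ≤ 2 ^ n ∧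
      ∀ f ∈ K, ∃ x ∈ A, dist f x ≤ 2 * entropyNumber n K := by
  classical
  have hpos : 0 < 2 ^ n := by positivity
  rcases (entropyNumber_nonneg n K).eq_or_lt with h0 | h0
  · have hfin : K.Finite := by
      by_contra hinf
      obtain ⟨T, hT, hTc⟩ := Set.Infinite.exists_subset_card_eq hinf (2 ^ n + 1)
      have := card_le_of_entropyNumber_eq_zero hK h0.symm T hT
      omega
    rcases K.eq_empty_or_nonempty with rfl | hne
    · exact ⟨{0}, Finset.singleton_nonempty 0, by rw [Finset.card_singleton]; exact hpos, by simp⟩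
    · refine ⟨hfin.toFinset, by simpa using hne, ?_, fun f hf => ⟨f, by simpa using hf, ?_⟩⟩
      · exact card_le_of_entropyNumber_eq_zero hK h0.symm _ (by simp)
      · simp [← h0]
  · set s := {ε : ℝ | 0 < ε ∧ ∃ c : Fin (2 ^ n) → X, K ⊆ ⋃ i, Metric.closedBall (c i) ε} with hs
    have hdef : entropyNumber n K = sInf s := rfl
    -- The infimum of the empty set is `0` by convention, which `h0` excludes.
    have hsne : s.Nonempty := by
      by_contra hemp
      rw [Set.not_nonempty_iff_eq_empty] at hemp
      rw [hdef, hemp, Real.sInf_empty] at h0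
      exact lt_irrefl _ h0
    obtain ⟨ε, ⟨-, c, hc⟩, hlt⟩ := exists_lt_of_csInf_lt hsne
      (show sInf s < 2 * entropyNumber n K by rw [← hdef]; linarith)
    refine ⟨Finset.univ.image c, ⟨c ⟨0, hpos⟩, by simp⟩, ?_, fun f hf => ?_⟩
    · exact Finset.card_image_le.trans (by simp)
    · obtain ⟨i, hi⟩ := Set.mem_iUnion.1 (hc hf)
      exact ⟨c i, by simp, (Metric.mem_closedBall.1 hi).trans hlt.le⟩

/-- `2 ^ n` points of a Banach space factor through `ℓ_∞^{26 n}` by maps with Lipschitz constants of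
order `n ^ (5/4)`. -/
theorem exists_lipschitz_factorization {X : Type u} [NormedAddCommGroup X] [NormedSpace ℝ X]
    [CompleteSpace X] {A : Finset X} (hne : A.Nonempty) {n : ℕ} (hn : 1 ≤ n)
    (hA : A.card ≤ 2 ^ n) :
    ∃ (a : X → (Fin (26 * n) → ℝ)) (M : (Fin (26 * n) → ℝ) → X),
      LipschitzWith (2 * (n : ℝ≥0) ^ (5 / 4 : ℝ)) a ∧
      LipschitzWith (208000 * (n : ℝ≥0) ^ (5 / 4 : ℝ)) M ∧ ∀ x ∈ A, M (a x) = x := by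
  have hn0 : (0 : ℝ) < n := by exact_mod_cast hn
  have hn0' : (n : ℝ≥0) ≠ 0 := by exact_mod_cast (by omega : n ≠ 0)
  obtain ⟨F, hF, hFA⟩ := exists_embedding hn hA
  set lam : ℝ≥0 := (n : ℝ≥0) ^ (1 / 4 : ℝ) with hlam
  have hlam0 : 0 < lam := NNReal.rpow_pos (pos_iff_ne_zero.2 hn0')
  set a : X → (Fin (26 * n) → ℝ) := fun x => (lam : ℝ) • F x with ha
  have hdist : ∀ x y, dist (a x) (a y) = lam * dist (F x) (F y) := by
    intro x y
    rw [ha, dist_smul₀, Real.norm_of_nonneg lam.coe_nonneg]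
  obtain ⟨N, hN⟩ : ∃ N, A.card = N + 1 := Nat.exists_eq_succ_of_ne_zero hne.card_pos.ne'
  set e := A.equivFinOfCardEq hN with he
  set x : ℕ → X := fun i => (e.symm (Fin.ofNat (N + 1) i) : X) with hx
  have hxA : ∀ i, x i ∈ A := fun i => (e.symm _).2
  obtain ⟨M, hM, hMx⟩ := exists_lipschitz_extension (by omega : 1 ≤ 26 * n) (fun i => a (x i)) x N
    -- The extension multiplies this by `40 · 26 n`, giving `208000 n √n / lam`.
    (200 * NNReal.sqrt n / lam) (fun i _ k _ => by
      rw [hdist]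
      push_cast
      refine (hFA _ (hxA i) _ (hxA k)).trans_eq ?_
      have : (lam : ℝ) ≠ 0 := by exact_mod_cast hlam0.ne'
      field_simp)
  refine ⟨a, M, ?_, ?_, fun y hy => ?_⟩
  · refine LipschitzWith.of_dist_le_mul fun y z => ?_
    rw [hdist]
    have h1 := mul_le_mul_of_nonneg_left (hF.dist_le_mul y z) lam.coe_nonneg
    refine h1.trans_eq ?_
    have h2 : (n : ℝ≥0) ^ (5 / 4 : ℝ) = lam * n := by
      rw [hlam, show (5 / 4 : ℝ) = 1 / 4 + 1 by norm_num, NNReal.rpow_add hn0', NNReal.rpow_one]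
    rw [h2]
    push_cast
    ring
  · refine hM.weaken (le_of_eq ?_)
    have h2 : (n : ℝ≥0) ^ (5 / 4 : ℝ) = n * NNReal.sqrt n / lam := by
      rw [hlam, NNReal.sqrt_eq_rpow, show (5 / 4 : ℝ) = 1 + 1 / 2 - 1 / 4 by norm_num,
        NNReal.rpow_sub hn0', NNReal.rpow_add hn0', NNReal.rpow_one]
    rw [h2]
    push_cast
    ring
  · have := hMx (e ⟨y, hy⟩).1 (by have := (e ⟨y, hy⟩).2; omega)
    have hxy : x (e ⟨y, hy⟩).1 = y := by
      simp only [hx]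
      rw [Fin.ofNat_val_eq_self]
      simp
    simpa only [hxy] using this

/-- `Fin (26 * n) → ℝ` carries the sup norm, i.e. it is `ℓ_∞^{26n}`. -/
theorem theorem5p1 :
    ∃ C : ℝ≥0, 0 < C ∧
      ∀ (X : Type u) [NormedAddCommGroup X] [NormedSpace ℝ X] [CompleteSpace X]
        (K : Set X), IsCompact K →
        ∀ n : ℕ, 1 ≤ n →
          ∃ (a : X → (Fin (26 * n) → ℝ)) (M : (Fin (26 * n) → ℝ) → X),
            LipschitzWith (C * (n : ℝ≥0) ^ (5 / 4 : ℝ)) a ∧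
            LipschitzWith (C * (n : ℝ≥0) ^ (5 / 4 : ℝ)) M ∧
            ∀ f ∈ K, ‖f - M (a f)‖ ≤ (C : ℝ) * (n : ℝ) ^ (5 / 2 : ℝ) * entropyNumber n K := by
  refine ⟨1000000, by norm_num, fun X _ _ _ K hK n hn => ?_⟩
  obtain ⟨A, hne, hA, hnet⟩ := exists_net_entropyNumber hK n
  obtain ⟨a, M, ha, hM, hMa⟩ := exists_lipschitz_factorization hne hn hA
  refine ⟨a, M, ha.weaken (mul_le_mul_left (by norm_num) _),
    hM.weaken (mul_le_mul_left (by norm_num) _), fun f hf => ?_⟩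
  obtain ⟨x, hx, hfx⟩ := hnet f hf
  have hn1 : (1 : ℝ) ≤ n := by exact_mod_cast hn
  set P : ℝ := (n : ℝ) ^ (5 / 4 : ℝ) with hP
  have hP1 : 1 ≤ P := Real.one_le_rpow hn1 (by norm_num)
  have hPP : (n : ℝ) ^ (5 / 2 : ℝ) = P * P := by
    rw [hP, ← Real.rpow_add (by linarith)]
    norm_num
  have h1 : dist x (M (a f)) ≤ 208000 * P * (2 * P * dist f x) := by
    have e1 := hM.dist_le_mul (a x) (a f)
    have e2 := ha.dist_le_mul x f
    rw [hMa x hx] at e1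
    push_cast at e1 e2
    rw [dist_comm x f] at e2
    exact e1.trans (mul_le_mul_of_nonneg_left e2 (by positivity))
  have hE := entropyNumber_nonneg n K
  rw [← dist_eq_norm, hPP]
  have hd0 : 0 ≤ dist f x := dist_nonneg
  have hPP1 : 1 ≤ P * P := by nlinarith
  calc dist f (M (a f)) ≤ dist f x + dist x (M (a f)) := dist_triangle _ _ _
    _ ≤ dist f x + 416000 * (P * P) * dist f x := by linarith
    _ ≤ 417000 * (P * P) * dist f x := by nlinarith
    _ ≤ 417000 * (P * P) * (2 * entropyNumber n K) :=
        mul_le_mul_of_nonneg_left hfx (by positivity)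
    _ ≤ ((1000000 : ℝ≥0) : ℝ) * (P * P) * entropyNumber n K := by
        push_cast
        have : 0 ≤ P * P * entropyNumber n K := by positivity
        nlinarith
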